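/- All homology is singular homology with integer coefficients. A covering $\pi:X\to Y$ of path-connected topological spaces is called \emph{inductive} if the map $\pi_1'(X)\to\pi_1'(Y)$ it induces between the commutator subgroups of the fundamental groups is an isomorphism (in this case $\pi_*:H_1(X)\to H_1(Y)$ is injective). An inductive covering is called \emph{strongly inductive} if, moreover, $\pi_*$ restricts to an isomorphism between the torsion subgroups of $H_1(X)$ and $H_1(Y)$. For a subgroup $M\subset H_1(Y)$, a subset $V\subset Y$ with inclusion $j:V\hookrightarrow Y$ is called \emph{$M$-inductively connected} if $V$ is (non-empty and) path-connected and $j_*H_1(V)+M=H_1(Y)$; similarly for subsets of $X$ and subgroups of $H_1(X)$. \textbf{Theorem.} Let $\pi:X\to Y$ be a strongly inductive covering of finite degree. (1) Let $V\subset Y$ be a subset and $L\subset H_1(X)$ a subgroup. If $V$ is $(\pi_*L)$-inductively connected, then $\pi^{-1}(V)\subset X$ is $L$-inductively connected. (2) Let $V\subset Y$ be a (non-empty) path-connected subset with inclusion $j:V\hookrightarrow Y$. Then $\pi^{-1}(V)$ is path-connected if and only if $$j_*H_1(V)+\pi_*H_1(X)=H_1(Y).$$ -/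

import Mathlib

open CategoryTheory

universe u

/-- First singular homology with integer coefficients, `H₁(X) = H₁(X; ℤ)`. -/
noncomputable def H1 (X : Type u) [TopologicalSpace X] : ModuleCat.{u} ℤ :=
  ((AlgebraicTopology.singularHomologyFunctor (ModuleCat.{u} ℤ) 1).obj
    (ModuleCat.of ℤ (ULift.{u} ℤ))).obj (TopCat.of X)

/-- The homomorphism `f_* : H₁(X) → H₁(Y)` induced by a continuous map `f`. -/
noncomputable def H1.map {X Y : Type u} [TopologicalSpace X] [TopologicalSpace Y]
    (f : C(X, Y)) : H1 X →+ H1 Y :=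
  (((AlgebraicTopology.singularHomologyFunctor (ModuleCat.{u} ℤ) 1).obj
    (ModuleCat.of ℤ (ULift.{u} ℤ))).map (TopCat.ofHom f)).hom.toAddMonoidHom

/-- The inclusion of a subset, with the subspace topology, as a continuous map. -/
def subsetIncl {X : Type u} [TopologicalSpace X] (V : Set X) : C(V, X) :=
  ⟨Subtype.val, continuous_subtype_val⟩

/-- A covering `π : X → Y` of path-connected spaces is *inductive* if the map
`π₁'(X) → π₁'(Y)` of commutator subgroups of the fundamental groups induced by `π` is an
isomorphism, for every choice of the base point in `X`. -/
structure IsInductiveCovering {X Y : Type u} [TopologicalSpace X] [TopologicalSpace Y]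
    (π : C(X, Y)) : Prop where
  pathConnected_source : PathConnectedSpace X
  pathConnected_target : PathConnectedSpace Y
  isCoveringMap : IsCoveringMap π
  bijOn_commutator : ∀ x : X, Set.BijOn (FundamentalGroup.map π x)
    (commutator (FundamentalGroup X x) : Set (FundamentalGroup X x))
    (commutator (FundamentalGroup Y (π x)) : Set (FundamentalGroup Y (π x)))

/-- An inductive covering `π : X → Y` is *strongly inductive* if the map `H₁ᵀ(X) → H₁ᵀ(Y)` of
torsion subgroups induced by `π` is an isomorphism. -/
structure IsStronglyInductiveCovering {X Y : Type u} [TopologicalSpace X] [TopologicalSpace Y]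
    (π : C(X, Y)) : Prop extends IsInductiveCovering π where
  bijOn_torsion : Set.BijOn (H1.map π)
    (AddCommGroup.torsion (H1 X) : Set (H1 X)) (AddCommGroup.torsion (H1 Y) : Set (H1 Y))

/-- For a subgroup `L ⊆ H₁(Y)`, a subset `V ⊆ Y` is *`L`-inductively connected* if it is
path-connected and the image of `H₁(V)` together with `L` generates `H₁(Y)`. -/
def IsInductivelyConnected {Y : Type u} [TopologicalSpace Y]
    (L : AddSubgroup (H1 Y)) (V : Set Y) : Prop :=
  IsPathConnected V ∧ (H1.map (subsetIncl V)).range ⊔ L = ⊤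

/-!
The argument translates statements about `H₁` into statements about loops, by the Hurewicz theorem
in degree one, `H₁(Z) = π₁(Z)ᵃᵇ` for path-connected `Z`, which is proved here for Mathlib's singular
homology (`hurewicz_surjective`, `ker_hurewicz_le`, `hurewicz_map`), and then lifts the loops.

For the Hurewicz theorem, `H₁(Z)` is viewed inside the group of `1`-chains modulo boundaries, the
opcycles of the singular chain complex, as the kernel of the boundary map to `0`-chains. Every path
has a class there; classes are invariant under homotopy relative to the endpoints and additive
under concatenation, because suitable `2`-simplices have the required edges. This gives the Hurewicz
map. Conversely, fix paths from the base point `z` to all points. Closing up a path to a loop at `z`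
by means of them turns every homomorphism from `π₁(Z, z)` to an abelian group into a homomorphism
on opcycles (`opcyclesOfHom`), because the two ways along the edges of a `2`-simplex are homotopic.
Applied to the abelianization, this bounds the kernel of the Hurewicz map; applied to the Hurewicz
map itself, it gives surjectivity, since closing up changes a chain only by a term that depends on
its boundary.

For the covering, the Hurewicz theorem and the isomorphism of commutator subgroups show that a loop
`γ` at `π x` whose homology class is `π_* a` is the image of a loop at `x` of class `a`
(`exists_map_eq_of_hurewicz_eq`). Now let `V ⊆ Y` be path-connected and `U = π⁻¹(V)`.

* If `j_* H₁(V) + π_* H₁(X) = H₁(Y)`, take a path in `X` between two points of a fibre over `V`. Its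
  image in `Y` is homotopic to the image of a loop in `X` followed by a loop in `V`, so the lift of
  the loop in `V` joins the two points inside `U`.
* If `U` is path-connected, the endpoints of the lift of a loop in `Y` at a point of `V` are joined
  by a path in `U`, and this splits the class of the loop into a part from `X` and a part from `V`.
* If `π_* c = j_* v + π_* l`, represent `v` by a loop in `V`. As `j_* v = π_* (c - l)`, this loop
  lifts to a loop in `U` whose class in `X` is `c - l`.
-/

open CategoryTheory AlgebraicTopology Simplicial unitInterval

namespace SingularH1

noncomputable section

/-! ### Singular chains as free abelian groups -/

/-- The coefficient module `ℤ`, lifted to the universe of the spaces. -/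
abbrev coeffs : ModuleCat.{u} ℤ := ModuleCat.of ℤ (ULift.{u} ℤ)

/-- The singular chain complex of `Z` with integer coefficients; its first homology is
definitionally `H1 Z`. -/
abbrev chains (Z : Type u) [TopologicalSpace Z] : ChainComplex (ModuleCat.{u} ℤ) ℕ :=
  (TopCat.toSSet.obj (TopCat.of Z)).chainComplex coeffs

variable {Z : Type u} [TopologicalSpace Z] {W : Type u} [TopologicalSpace W]

/-- A continuous map from the standard simplex, as a simplex of the singular simplicial set. -/
def simplex {n : ℕ} (f : C(stdSimplex ℝ (Fin (n + 1)), Z)) :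
    (TopCat.toSSet.obj (TopCat.of Z)) _⦋n⦌ :=
  (TopCat.toSSetObjEquiv (TopCat.of Z) (Opposite.op ⦋n⦌)).symm f

lemma simplex_surjective (n : ℕ) :
    Function.Surjective (simplex (Z := Z) (n := n)) :=
  (TopCat.toSSetObjEquiv (TopCat.of Z) (Opposite.op ⦋n⦌)).symm.surjective

/-- The inclusion of the `i`-th face, opposite to the `i`-th vertex, of the standard simplex. -/
def face {n : ℕ} (i : Fin (n + 2)) :
    C(stdSimplex ℝ (Fin (n + 1)), stdSimplex ℝ (Fin (n + 2))) :=
  ⟨stdSimplex.map i.succAbove, stdSimplex.continuous_map _⟩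

lemma coeffs_hom_ext {A : ModuleCat.{u} ℤ} {φ ψ : coeffs.{u} ⟶ A}
    (h : φ.hom ⟨1⟩ = ψ.hom ⟨1⟩) : φ = ψ := by
  ext ⟨n⟩
  have e : (⟨n⟩ : coeffs.{u}) = n • (⟨1⟩ : coeffs.{u}) :=
    ULift.ext _ _ (mul_one n).symm
  change φ.hom _ = ψ.hom _
  rw [e, map_zsmul, map_zsmul, h]

/-- The singular chain consisting of one simplex with coefficient one. -/
def single {n : ℕ} (f : C(stdSimplex ℝ (Fin (n + 1)), Z)) : (chains Z).X n :=
  ((TopCat.toSSet.obj (TopCat.of Z)).ιChainComplex (R := coeffs) (simplex f)).hom ⟨1⟩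

lemma chains_hom_ext {n : ℕ} {A : ModuleCat.{u} ℤ} {φ ψ : (chains Z).X n ⟶ A}
    (h : ∀ f : C(stdSimplex ℝ (Fin (n + 1)), Z), φ.hom (single f) = ψ.hom (single f)) :
    φ = ψ := by
  refine SSet.chainComplex_hom_ext fun s ↦ ?_
  obtain ⟨f, rfl⟩ := simplex_surjective n s
  exact coeffs_hom_ext (h f)

/-- The homomorphism on singular `n`-chains with prescribed values on the simplices. -/
def chainsDesc {n : ℕ} {A : Type u} [AddCommGroup A]
    (w : C(stdSimplex ℝ (Fin (n + 1)), Z) → A) : (chains Z).X n ⟶ ModuleCat.of ℤ A :=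
  ((TopCat.toSSet.obj (TopCat.of Z)).isColimitChainComplexXCofan coeffs n).desc
    (Limits.Cofan.mk _ fun s ↦ ModuleCat.ofHom
      (((LinearMap.toSpanSingleton ℤ A (w (TopCat.toSSetObjEquiv _ (Opposite.op ⦋n⦌) s))).comp
        (ULift.moduleEquiv (R := ℤ) (M := ℤ)).toLinearMap)))

lemma chainsDesc_single {n : ℕ} {A : Type u} [AddCommGroup A]
    (w : C(stdSimplex ℝ (Fin (n + 1)), Z) → A) (f : C(stdSimplex ℝ (Fin (n + 1)), Z)) :
    (chainsDesc w).hom (single f) = w f := by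
  have h := ((TopCat.toSSet.obj (TopCat.of Z)).isColimitChainComplexXCofan coeffs n).fac
    (Limits.Cofan.mk _ fun s ↦ ModuleCat.ofHom
      (((LinearMap.toSpanSingleton ℤ A (w (TopCat.toSSetObjEquiv _ (Opposite.op ⦋n⦌) s))).comp
        (ULift.moduleEquiv (R := ℤ) (M := ℤ)).toLinearMap))) ⟨simplex f⟩
  refine (congr($(h).hom ⟨1⟩)).trans ?_
  change (1 : ℤ) • w (TopCat.toSSetObjEquiv _ (Opposite.op ⦋n⦌) (simplex f)) = w f
  rw [one_smul]
  exact congrArg w (Equiv.apply_symm_apply _ _)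

lemma d_single {n : ℕ} (f : C(stdSimplex ℝ (Fin (n + 2)), Z)) :
    ((chains Z).d (n + 1) n).hom (single f) =
      ∑ i : Fin (n + 2), (-1) ^ i.val • single (f.comp (face i)) := by
  have h := congr($((TopCat.toSSet.obj (TopCat.of Z)).ιChainComplex_d (R := coeffs)
    (simplex f)).hom ⟨1⟩)
  refine Eq.trans h ?_
  simp [ModuleCat.hom_sum]
  rfl

lemma map_single (g : C(Z, W)) {n : ℕ} (f : C(stdSimplex ℝ (Fin (n + 1)), Z)) :
    ((SSet.chainComplexMap (TopCat.toSSet.map (TopCat.ofHom g)) coeffs).f n).hom (single f) =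
      single (g.comp f) :=
  congr($(SSet.ι_chainComplexMap_f _ _ (TopCat.toSSet.map (TopCat.ofHom g)) coeffs
    (simplex f)).hom ⟨1⟩)

/-! ### One-chains modulo boundaries -/

/-- A path, as a map from the standard `1`-simplex; `0` and `1` in the unit interval correspond
to the vertices `0` and `1`. -/
def toSimplex (f : C(I, Z)) : C(stdSimplex ℝ (Fin 2), Z) :=
  f.comp (stdSimplexHomeomorphUnitInterval : C(stdSimplex ℝ (Fin 2), I))

/-- The `i`-th face of the standard `2`-simplex as a path, running from the smaller to the larger of
its two vertices. -/
def edge (i : Fin 3) : C(I, stdSimplex ℝ (Fin 3)) :=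
  (face (n := 1) i).comp (stdSimplexHomeomorphUnitInterval.symm : C(I, stdSimplex ℝ (Fin 2)))

lemma toSimplex_surjective : Function.Surjective (toSimplex (Z := Z)) := fun f ↦
  ⟨f.comp (stdSimplexHomeomorphUnitInterval.symm : C(I, stdSimplex ℝ (Fin 2))), by
    ext x; simp [toSimplex]⟩

lemma toSimplex_comp_edge (F : C(stdSimplex ℝ (Fin 3), Z)) (i : Fin 3) :
    toSimplex (F.comp (edge i)) = F.comp (face i) := by
  ext x; simp [toSimplex, edge]

lemma face_apply_self {n : ℕ} (i : Fin (n + 2)) (s : stdSimplex ℝ (Fin (n + 1))) :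
    face i s i = 0 := by
  change FunOnFinite.linearMap ℝ ℝ i.succAbove s i = 0
  rw [FunOnFinite.linearMap_apply_apply]
  exact Finset.sum_eq_zero fun j hj ↦ absurd (Finset.mem_filter.1 hj).2 (Fin.succAbove_ne i j)

lemma face_apply_succAbove {n : ℕ} (i : Fin (n + 2)) (s : stdSimplex ℝ (Fin (n + 1)))
    (j : Fin (n + 1)) : face i s (i.succAbove j) = s j := by
  change FunOnFinite.linearMap ℝ ℝ i.succAbove s (i.succAbove j) = s j
  rw [FunOnFinite.linearMap_apply_apply]
  simp [Finset.filter_eq']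

lemma edge_apply_self (i : Fin 3) (t : I) : edge i t i = 0 := face_apply_self _ _

lemma edge_apply_succAbove_zero (i : Fin 3) (t : I) : edge i t (i.succAbove 0) = 1 - t :=
  face_apply_succAbove ..

lemma edge_apply_succAbove_one (i : Fin 3) (t : I) : edge i t (i.succAbove 1) = t :=
  face_apply_succAbove ..

/-- A point, as a singular `0`-chain. -/
def pt (z : Z) : (chains Z).X 0 := single (.const _ z)

/-- The class of a path in the group of singular `1`-chains modulo boundaries. -/
def edgeClass (f : C(I, Z)) : (chains Z).opcycles 1 :=
  ((chains Z).pOpcycles 1).hom (single (toSimplex f))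

/-- The homomorphism on singular `0`-chains with prescribed values on points. -/
def zeroChainsDesc {A : Type u} [AddCommGroup A] (w : Z → A) : (chains Z).X 0 →+ A :=
  (chainsDesc fun s ↦ w (s default)).hom.toAddMonoidHom

lemma zeroChainsDesc_pt {A : Type u} [AddCommGroup A] (w : Z → A) (z : Z) :
    zeroChainsDesc w (pt z) = w z :=
  chainsDesc_single (n := 0) (fun s ↦ w (s default)) (.const _ z)

lemma d_toSimplex (f : C(I, Z)) :
    ((chains Z).d 1 0).hom (single (toSimplex f)) = pt (f 1) - pt (f 0) := by
  rw [d_single, Fin.sum_univ_two]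
  have h (i : Fin 2) (t : I) (ht : ∀ s, (face (n := 0) i s) 1 = t) :
      (toSimplex f).comp (face i) = .const _ (f t) := by
    ext s
    exact congrArg f (Subtype.ext (ht s))
  rw [h 0 1 fun s ↦ (face_apply_succAbove 0 s 0).trans (by simp),
    h 1 0 fun s ↦ face_apply_self 1 s]
  simp [pt, sub_eq_add_neg]

/-- The boundary map from `1`-chains modulo boundaries to `0`-chains. -/
def boundary : (chains Z).opcycles 1 →+ (chains Z).X 0 :=
  ((chains Z).fromOpcycles 1 0).hom.toAddMonoidHom

lemma boundary_edgeClass (f : C(I, Z)) : boundary (edgeClass f) = pt (f 1) - pt (f 0) :=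
  (congr($((chains Z).p_fromOpcycles 1 0).hom (single (toSimplex f)))).trans (d_toSimplex f)

lemma d_single_two (F : C(stdSimplex ℝ (Fin 3), Z)) :
    ((chains Z).d 2 1).hom (single F) = single (F.comp (face 0)) - single (F.comp (face 1)) +
      single (F.comp (face 2)) := by
  rw [d_single, Fin.sum_univ_three]
  simp [sub_eq_add_neg]

/-- The boundary of a singular `2`-simplex vanishes modulo boundaries. -/
lemma edgeClass_add (F : C(stdSimplex ℝ (Fin 3), Z)) :
    edgeClass (F.comp (edge 2)) + edgeClass (F.comp (edge 0)) = edgeClass (F.comp (edge 1)) := by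
  have h := congr($((chains Z).d_pOpcycles 2 1).hom (single F))
  simp only [ModuleCat.hom_comp, LinearMap.comp_apply, d_single_two, ← toSimplex_comp_edge,
    map_add, map_sub] at h
  change edgeClass _ - edgeClass _ + edgeClass _ = 0 at h
  rw [← sub_eq_zero, ← h]
  abel

/-- The homomorphism on `1`-chains modulo boundaries with prescribed values on paths, which have to
be compatible along the edges of every singular `2`-simplex. -/
def opcyclesDesc {A : Type u} [AddCommGroup A] (w : C(I, Z) → A)
    (hw : ∀ F : C(stdSimplex ℝ (Fin 3), Z),
      w (F.comp (edge 2)) + w (F.comp (edge 0)) = w (F.comp (edge 1))) :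
    (chains Z).opcycles 1 →+ A :=
  ((chains Z).descOpcycles (i := 1) (A := ModuleCat.of ℤ A)
    (chainsDesc fun f ↦ w (f.comp (stdSimplexHomeomorphUnitInterval.symm : C(I, _)))) 2 (by simp)
    (chains_hom_ext fun F ↦ by
      simp only [ModuleCat.hom_comp, LinearMap.comp_apply, d_single_two, map_add, map_sub]
      refine (congrArg₂ (· + ·) (congrArg₂ (· - ·) (chainsDesc_single ..) (chainsDesc_single ..))
        (chainsDesc_single ..)).trans ?_
      change w (F.comp (edge 0)) - w (F.comp (edge 1)) + w (F.comp (edge 2)) = 0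
      rw [← hw F]
      abel)).hom.toAddMonoidHom

lemma opcyclesDesc_edgeClass {A : Type u} [AddCommGroup A] (w : C(I, Z) → A)
    (hw : ∀ F : C(stdSimplex ℝ (Fin 3), Z),
      w (F.comp (edge 2)) + w (F.comp (edge 0)) = w (F.comp (edge 1))) (f : C(I, Z)) :
    opcyclesDesc w hw (edgeClass f) = w f := by
  refine (congr($((chains Z).p_descOpcycles (i := 1) (A := ModuleCat.of ℤ A)
    (chainsDesc fun f ↦ w (f.comp (stdSimplexHomeomorphUnitInterval.symm : C(I, _)))) 2 (by simp)
    _).hom (single (toSimplex f)))).trans ?_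
  rw [chainsDesc_single]
  simp [toSimplex, ContinuousMap.comp_assoc]

lemma opcycles_addHom_ext {A : Type u} [AddCommGroup A] {φ ψ : (chains Z).opcycles 1 →+ A}
    (h : ∀ f, φ (edgeClass f) = ψ (edgeClass f)) : φ = ψ := by
  let asHom (φ : (chains Z).opcycles 1 →+ A) : (chains Z).opcycles 1 ⟶ ModuleCat.of ℤ A :=
    ModuleCat.ofHom { φ with
      map_smul' := fun n x ↦ (congrArg φ (int_smul_eq_zsmul _ n x)).trans (map_zsmul φ n x) }
  have : (chains Z).pOpcycles 1 ≫ asHom φ =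
      (chains Z).pOpcycles 1 ≫ asHom ψ :=
    chains_hom_ext fun f ↦ by
      obtain ⟨f, rfl⟩ := toSimplex_surjective f
      exact h f
  ext x
  exact congr($((cancel_epi _).1 this).hom x)

/-- The inclusion of `H₁(Z)` in the `1`-chains modulo boundaries. Its image is the kernel of
`boundary`. -/
def toOpcycles : H1 Z →+ (chains Z).opcycles 1 :=
  ((chains Z).homologyι 1).hom.toAddMonoidHom

lemma toOpcycles_injective : Function.Injective (toOpcycles (Z := Z)) :=
  (ModuleCat.mono_iff_injective _).1 (inferInstanceAs (Mono ((chains Z).homologyι 1)))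

lemma boundary_toOpcycles (x : H1 Z) : boundary (toOpcycles x) = 0 :=
  congr($((chains Z).homologyι_comp_fromOpcycles 1 0).hom x)

lemma exists_toOpcycles_eq {f : C(I, Z)} (hf : f 0 = f 1) :
    ∃ x : H1 Z, toOpcycles x = edgeClass f := by
  have h : (TopCat.toSSet.obj (TopCat.of Z)).ιChainComplex (R := coeffs) (simplex (toSimplex f)) ≫
      (chains Z).d 1 0 = 0 :=
    coeffs_hom_ext ((d_toSimplex f).trans (by rw [hf, sub_self]; rfl))
  refine ⟨((chains Z).liftCycles (i := 1) _ 0 (by simp) h ≫ (chains Z).homologyπ 1).hom ⟨1⟩, ?_⟩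
  have := (chains Z).homology_π_ι 1
  refine congr($(show ((chains Z).liftCycles (i := 1) _ 0 (by simp) h ≫
    (chains Z).homologyπ 1) ≫ (chains Z).homologyι 1 = _ ≫ (chains Z).pOpcycles 1 from ?_).hom ⟨1⟩)
  rw [Category.assoc, this, HomologicalComplex.liftCycles_i_assoc]

lemma toOpcycles_map (g : C(Z, W)) (x : H1 Z) (f : C(I, Z)) (hx : toOpcycles x = edgeClass f) :
    toOpcycles (H1.map g x) = edgeClass (g.comp f) := by
  let φ := SSet.chainComplexMap (TopCat.toSSet.map (TopCat.ofHom g)) coeffs.{u}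
  have h₁ : toOpcycles (H1.map g x) = (HomologicalComplex.opcyclesMap φ 1).hom (toOpcycles x) :=
    congr($(HomologicalComplex.homologyι_naturality φ 1).hom x)
  have h₂ := congr($(HomologicalComplex.p_opcyclesMap φ 1).hom (single (toSimplex f)))
  rw [h₁, hx]
  refine h₂.trans ?_
  exact congrArg ((chains W).pOpcycles 1).hom (map_single g (toSimplex f))

/-! ### Homotopy invariance and additivity of the class of a path -/

lemma edgeClass_const (z : Z) : edgeClass (.const I z) = 0 := by
  simpa using edgeClass_add (.const _ z)

lemma stdSimplex_sum_three (s : stdSimplex ℝ (Fin 3)) : s 0 + s 1 + s 2 = 1 := by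
  rw [← Fin.sum_univ_three, stdSimplex.sum_eq_one]

/-- The sum of two distinct barycentric coordinates of the `2`-simplex. -/
def coordAdd (i j : Fin 3) (hij : i ≠ j) : C(stdSimplex ℝ (Fin 3), I) where
  toFun s := ⟨s i + s j, add_nonneg (s.2.1 i) (s.2.1 j), by
    rw [← stdSimplex.sum_eq_one s, ← Finset.sum_pair hij]
    exact Finset.sum_le_sum_of_subset_of_nonneg (Finset.subset_univ _) fun k _ _ ↦ s.2.1 k⟩
  continuous_toFun := by
    have (k : Fin 3) : Continuous fun s : stdSimplex ℝ (Fin 3) ↦ s k :=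
      (continuous_apply k).comp continuous_subtype_val
    exact ((this i).add (this j)).subtype_mk _

/-- A barycentric coordinate of the `2`-simplex, as a map to the unit interval. -/
def coord (i : Fin 3) : C(stdSimplex ℝ (Fin 3), I) where
  toFun s := ⟨s i, s.2.1 i, stdSimplex.le_one s i⟩
  continuous_toFun := ((continuous_apply i).comp continuous_subtype_val).subtype_mk _

lemma edge_zero_apply (t : I) : edge 0 t 0 = 0 ∧ edge 0 t 1 = 1 - t ∧ edge 0 t 2 = t :=
  ⟨edge_apply_self 0 t, edge_apply_succAbove_zero 0 t, edge_apply_succAbove_one 0 t⟩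

lemma edge_one_apply (t : I) : edge 1 t 0 = 1 - t ∧ edge 1 t 1 = 0 ∧ edge 1 t 2 = t :=
  ⟨edge_apply_succAbove_zero 1 t, edge_apply_self 1 t, edge_apply_succAbove_one 1 t⟩

lemma edge_two_apply (t : I) : edge 2 t 0 = 1 - t ∧ edge 2 t 1 = t ∧ edge 2 t 2 = 0 :=
  ⟨edge_apply_succAbove_zero 2 t, edge_apply_succAbove_one 2 t, edge_apply_self 2 t⟩

lemma edgeClass_eq_of_homotopic {x y : Z} {p q : Path x y} (h : p.Homotopic q) :
    edgeClass (p : C(I, Z)) = edgeClass (q : C(I, Z)) := by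
  obtain ⟨H⟩ := h
  -- The diagonal cuts the square into two triangles. Each has one constant edge, and the
  -- remaining edges are `p` and the diagonal, respectively the diagonal and `q`.
  have h₁ := edgeClass_add (H.toContinuousMap.comp ((coord 2).prodMk (coordAdd 1 2 (by decide))))
  have h₂ := edgeClass_add (H.toContinuousMap.comp ((coordAdd 1 2 (by decide)).prodMk (coord 2)))
  have e₁ : (H.toContinuousMap.comp ((coord 2).prodMk (coordAdd 1 2 (by decide)))).comp (edge 2) =
      (p : C(I, Z)) := by
    ext t
    simp [coord, coordAdd, edge_two_apply]
  have e₂ : (H.toContinuousMap.comp ((coord 2).prodMk (coordAdd 1 2 (by decide)))).comp (edge 0) =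
      .const I y := by
    ext t
    simp [coord, coordAdd, edge_zero_apply]
  have e₃ : (H.toContinuousMap.comp ((coordAdd 1 2 (by decide)).prodMk (coord 2))).comp (edge 2) =
      .const I x := by
    ext t
    simp [coord, coordAdd, edge_two_apply]
  have e₄ : (H.toContinuousMap.comp ((coordAdd 1 2 (by decide)).prodMk (coord 2))).comp (edge 0) =
      (q : C(I, Z)) := by
    ext t
    simp [coord, coordAdd, edge_zero_apply]
  have e₅ : (H.toContinuousMap.comp ((coord 2).prodMk (coordAdd 1 2 (by decide)))).comp (edge 1) =
      (H.toContinuousMap.comp ((coordAdd 1 2 (by decide)).prodMk (coord 2))).comp (edge 1) := by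
    ext t
    simp [coord, coordAdd, edge_one_apply]
  rw [e₁, e₂, edgeClass_const, add_zero] at h₁
  rw [e₃, e₄, edgeClass_const, zero_add] at h₂
  rw [h₁, h₂, e₅]

lemma edgeClass_trans {x y z : Z} (p : Path x y) (q : Path y z) :
    edgeClass (p.trans q : C(I, Z)) = edgeClass (p : C(I, Z)) + edgeClass (q : C(I, Z)) := by
  -- The affine map that sends the vertices `0`, `1`, `2` to `0`, `1 / 2`, `1`.
  let m : C(stdSimplex ℝ (Fin 3), I) :=
    { toFun s := ⟨s 1 / 2 + s 2, by
        have h := stdSimplex_sum_three s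
        have h0 : 0 ≤ s 0 := s.2.1 0
        have h1 : 0 ≤ s 1 := s.2.1 1
        have h2 : 0 ≤ s 2 := s.2.1 2
        constructor <;> linarith⟩
      continuous_toFun := by
        have (k : Fin 3) : Continuous fun s : stdSimplex ℝ (Fin 3) ↦ s k :=
          (continuous_apply k).comp continuous_subtype_val
        exact (((this 1).div_const 2).add (this 2)).subtype_mk _ }
  have h := edgeClass_add ((p.trans q : C(I, Z)).comp m)
  have e₂ : ((p.trans q : C(I, Z)).comp m).comp (edge 2) = (p : C(I, Z)) := by
    ext t
    have ht : (m (edge 2 t) : ℝ) = t / 2 := by simp [m, edge_two_apply]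
    change p.trans q (m (edge 2 t)) = p t
    rw [← Path.extend_apply, ht, Path.extend_trans_of_le_half _ _ (by linarith [t.2.2]),
      mul_div_cancel₀ _ two_ne_zero, Path.extend_apply]
  have e₀ : ((p.trans q : C(I, Z)).comp m).comp (edge 0) = (q : C(I, Z)) := by
    ext t
    have ht : (m (edge 0 t) : ℝ) = (1 + t) / 2 := by simp [m, edge_zero_apply]; ring
    change p.trans q (m (edge 0 t)) = q t
    rw [← Path.extend_apply, ht, Path.extend_trans_of_half_le _ _ (by linarith [t.2.1]),
      mul_div_cancel₀ _ two_ne_zero, add_sub_cancel_left, Path.extend_apply]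
  have e₁ : ((p.trans q : C(I, Z)).comp m).comp (edge 1) = (p.trans q : C(I, Z)) := by
    ext t
    have : m (edge 1 t) = t := Subtype.ext (by simp [m, edge_one_apply])
    simp [this]
  rw [e₀, e₁, e₂] at h
  exact h.symm

/-! ### The Hurewicz theorem in degree one -/

/-- The class, modulo boundaries, of a homotopy class of paths relative to the endpoints. -/
def homotopyClass {x y : Z} (γ : Path.Homotopic.Quotient x y) : (chains Z).opcycles 1 :=
  Quotient.lift (fun p : Path x y ↦ edgeClass (p : C(I, Z)))
    (fun _ _ h ↦ edgeClass_eq_of_homotopic h) γ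

lemma homotopyClass_mk {x y : Z} (p : Path x y) :
    homotopyClass (.mk p) = edgeClass (p : C(I, Z)) := rfl

lemma homotopyClass_trans {x y z : Z} (γ : Path.Homotopic.Quotient x y)
    (γ' : Path.Homotopic.Quotient y z) :
    homotopyClass (γ.trans γ') = homotopyClass γ + homotopyClass γ' := by
  induction γ using Path.Homotopic.Quotient.ind with | mk p =>
  induction γ' using Path.Homotopic.Quotient.ind with | mk q =>
  exact edgeClass_trans p q

lemma homotopyClass_symm {x y : Z} (γ : Path.Homotopic.Quotient x y) :
    homotopyClass γ.symm = -homotopyClass γ := by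
  rw [eq_neg_iff_add_eq_zero, ← homotopyClass_trans, Path.Homotopic.Quotient.symm_trans]
  exact edgeClass_const y

lemma exists_toOpcycles_eq_homotopyClass {z : Z} (γ : Path.Homotopic.Quotient z z) :
    ∃ x : H1 Z, toOpcycles x = homotopyClass γ := by
  induction γ using Path.Homotopic.Quotient.ind with | mk p =>
  exact exists_toOpcycles_eq (by simp)

/-- The homology class of a homotopy class of loops. -/
def loopClass {z : Z} (γ : Path.Homotopic.Quotient z z) : H1 Z :=
  (exists_toOpcycles_eq_homotopyClass γ).choose

lemma toOpcycles_loopClass {z : Z} (γ : Path.Homotopic.Quotient z z) :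
    toOpcycles (loopClass γ) = homotopyClass γ :=
  (exists_toOpcycles_eq_homotopyClass γ).choose_spec

/-- The Hurewicz homomorphism `π₁(Z, z) → H₁(Z)`. -/
def hurewicz (z : Z) : FundamentalGroup Z z →* Multiplicative (H1 Z) :=
  MonoidHom.mk' (fun γ ↦ .ofAdd (loopClass γ.toPath)) fun γ γ' ↦ by
    refine congrArg Multiplicative.ofAdd (toOpcycles_injective ?_)
    rw [map_add, toAdd_ofAdd, toAdd_ofAdd, toOpcycles_loopClass, toOpcycles_loopClass,
      toOpcycles_loopClass, add_comm]
    exact homotopyClass_trans γ'.toPath γ.toPath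

lemma toOpcycles_hurewicz {z : Z} (γ : FundamentalGroup Z z) :
    toOpcycles (hurewicz z γ).toAdd = homotopyClass γ.toPath :=
  toOpcycles_loopClass γ.toPath

theorem hurewicz_map (g : C(Z, W)) (z : Z) (γ : FundamentalGroup Z z) :
    (hurewicz (g z) (FundamentalGroup.map g z γ)).toAdd = H1.map g (hurewicz z γ).toAdd := by
  apply toOpcycles_injective
  rw [toOpcycles_hurewicz]
  obtain ⟨p, rfl⟩ := Path.Homotopic.Quotient.mk_surjective γ
  exact (toOpcycles_map g _ (p : C(I, Z)) (toOpcycles_hurewicz _)).symm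

/-- The edges of a singular `2`-simplex are paths that commute up to homotopy, because the standard
simplex is simply connected. -/
lemma triangle_homotopic (F : C(stdSimplex ℝ (Fin 3), Z)) :
    ∃ (x y z : Z) (p : Path x y) (q : Path y z) (r : Path x z),
      (p : C(I, Z)) = F.comp (edge 2) ∧ (q : C(I, Z)) = F.comp (edge 0) ∧
      (r : C(I, Z)) = F.comp (edge 1) ∧ (p.trans q).Homotopic r := by
  have : ContractibleSpace (stdSimplex ℝ (Fin 3)) :=
    (convex_stdSimplex ℝ (Fin 3)).contractibleSpace ⟨_, single_mem_stdSimplex ℝ 0⟩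
  let p : Path (edge 2 0) (edge 2 1) := ⟨edge 2, rfl, rfl⟩
  let q : Path (edge 2 1) (edge 0 1) := ⟨edge 0, by
    ext i; fin_cases i <;> simp [edge_zero_apply, edge_two_apply], rfl⟩
  let r : Path (edge 2 0) (edge 0 1) := ⟨edge 1, by
    ext i; fin_cases i <;> simp [edge_one_apply, edge_two_apply], by
    ext i; fin_cases i <;> simp [edge_one_apply, edge_zero_apply]⟩
  refine ⟨_, _, _, p.map F.continuous, q.map F.continuous, r.map F.continuous, rfl, rfl, rfl, ?_⟩
  rw [← Path.map_trans]
  exact (SimplyConnectedSpace.paths_homotopic (p.trans q) r).map F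

section PathConnected

variable [PathConnectedSpace Z]

/-- A chosen homotopy class of paths from the base point `z` to `x`. It need not be trivial for
`x = z`. -/
def basePath (z x : Z) : Path.Homotopic.Quotient z x :=
  .mk (PathConnectedSpace.somePath z x)

/-- The loop at `z` obtained from a path `γ` by adding the chosen paths to its two ends. -/
def closeUp (z : Z) {x y : Z} (γ : Path.Homotopic.Quotient x y) : FundamentalGroup Z z :=
  FundamentalGroup.fromPath (((basePath z x).trans γ).trans (basePath z y).symm)

lemma closeUp_trans (z : Z) {x y w : Z} (γ : Path.Homotopic.Quotient x y)
    (γ' : Path.Homotopic.Quotient y w) :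
    closeUp z (γ.trans γ') = closeUp z γ' * closeUp z γ := by
  have : (basePath z y).symm.trans ((basePath z y).trans (γ'.trans (basePath z w).symm)) =
      γ'.trans (basePath z w).symm := by
    rw [← Path.Homotopic.Quotient.trans_assoc, Path.Homotopic.Quotient.symm_trans,
      Path.Homotopic.Quotient.refl_trans]
  rw [FundamentalGroup.mul_def]
  simp only [closeUp, Path.Homotopic.Quotient.trans_assoc, this]

/-- Closing up a loop at `z` is conjugation, because the chosen path from `z` to `z` is a loop. -/
lemma closeUp_loop {z : Z} (γ : FundamentalGroup Z z) :
    closeUp z γ.toPath = (FundamentalGroup.fromPath (basePath z z))⁻¹ * γ *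
      FundamentalGroup.fromPath (basePath z z) := by
  rw [mul_assoc]
  rfl

/-- A homomorphism from `π₁(Z, z)` to an abelian group induces one on `1`-chains modulo boundaries,
by closing up paths to loops at `z`. -/
def opcyclesOfHom {A : Type u} [AddCommGroup A] (z : Z)
    (h : FundamentalGroup Z z →* Multiplicative A) : (chains Z).opcycles 1 →+ A :=
  opcyclesDesc (fun f ↦ (h (closeUp z (.mk ⟨f, rfl, rfl⟩))).toAdd) fun F ↦ by
    -- The endpoints of the edges agree only propositionally with those of `p`, `q` and `r`.
    have key {x y : Z} (p : Path x y) :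
        h (closeUp z (.mk (⟨(p : C(I, Z)), rfl, rfl⟩ : Path ((p : C(I, Z)) 0) ((p : C(I, Z)) 1)))) =
        h (closeUp z (.mk p)) := by
      obtain ⟨f, rfl, rfl⟩ := p
      rfl
    obtain ⟨x, y, w, p, q, r, hp, hq, hr, H⟩ := triangle_homotopic F
    rw [← hp, ← hq, ← hr, key, key, key, ← Path.Homotopic.Quotient.eq.2 H,
      Path.Homotopic.Quotient.mk_trans, closeUp_trans, map_mul, toAdd_mul, add_comm]

lemma opcyclesOfHom_edgeClass {A : Type u} [AddCommGroup A] (z : Z)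
    (h : FundamentalGroup Z z →* Multiplicative A) {x y : Z} (p : Path x y) :
    opcyclesOfHom z h (edgeClass (p : C(I, Z))) = (h (closeUp z (.mk p))).toAdd := by
  obtain ⟨f, rfl, rfl⟩ := p
  exact opcyclesDesc_edgeClass ..

/-- The injectivity part of the Hurewicz theorem in degree one. -/
theorem ker_hurewicz_le (z : Z) : (hurewicz z).ker ≤ commutator (FundamentalGroup Z z) := by
  intro γ hγ
  let h : FundamentalGroup Z z →*
      Multiplicative (Additive (Abelianization (FundamentalGroup Z z))) :=
    (MulEquiv.toMultiplicative_toAdditive).symm.toMonoidHom.comp Abelianization.of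
  have h₁ : opcyclesOfHom z h (toOpcycles (hurewicz z γ).toAdd) = 0 := by
    rw [MonoidHom.mem_ker.1 hγ, toAdd_one, map_zero, map_zero]
  rw [toOpcycles_hurewicz] at h₁
  obtain ⟨p, hp⟩ := Path.Homotopic.Quotient.mk_surjective γ.toPath
  rw [← hp, homotopyClass_mk, opcyclesOfHom_edgeClass, hp, closeUp_loop] at h₁
  replace h₁ := toAdd_eq_zero.1 h₁
  rw [map_mul, map_mul, map_inv, mul_comm, mul_inv_cancel_left] at h₁
  rw [← Abelianization.ker_of]
  exact h₁

/-- The surjectivity part of the Hurewicz theorem in degree one. -/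
theorem hurewicz_surjective (z : Z) : Function.Surjective (hurewicz z) := by
  -- It is enough that the quotient of `H₁(Z)` by the range of the Hurewicz map vanishes.
  let R : AddSubgroup (H1 Z) := (AddMonoidHom.toMultiplicativeRight.symm (hurewicz z)).range
  let q : H1 Z →+ H1 Z ⧸ R := QuotientAddGroup.mk' R
  let basePaths : (chains Z).X 0 →+ (chains Z).opcycles 1 :=
    zeroChainsDesc fun x ↦ homotopyClass (basePath z x)
  let Ψ := opcyclesOfHom z (hurewicz z)
  have h₁ : q.comp Ψ = 0 := opcycles_addHom_ext fun f ↦ by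
    refine (QuotientAddGroup.eq_zero_iff _).2 ?_
    exact ⟨.ofMul (closeUp z (.mk (⟨f, rfl, rfl⟩ : Path (f 0) (f 1)))),
      (opcyclesOfHom_edgeClass z (hurewicz z) _).symm⟩
  -- Closing up a path adds the chosen paths to its ends, so it changes a chain only by a term that
  -- depends on the boundary.
  have h₂ : toOpcycles.comp Ψ = AddMonoidHom.id _ - basePaths.comp boundary :=
    opcycles_addHom_ext fun f ↦ by
      let p : Path (f 0) (f 1) := ⟨f, rfl, rfl⟩
      have e : Ψ (edgeClass f) = (hurewicz z (closeUp z (.mk p))).toAdd :=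
        opcyclesOfHom_edgeClass z (hurewicz z) p
      have e' : edgeClass f = homotopyClass (.mk p) := rfl
      simp only [AddMonoidHom.comp_apply, AddMonoidHom.sub_apply, AddMonoidHom.id_apply, e,
        toOpcycles_hurewicz, boundary_edgeClass, map_sub, basePaths, zeroChainsDesc_pt, closeUp]
      rw [e', homotopyClass_trans, homotopyClass_trans, homotopyClass_symm]
      abel
  -- The boundary of a homology class is zero.
  intro x
  have h₃ : Ψ (toOpcycles x.toAdd) = x.toAdd := toOpcycles_injective <| by
    simpa [boundary_toOpcycles] using congr($h₂ (toOpcycles x.toAdd))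
  have h₄ : q x.toAdd = 0 := by
    simpa [h₃] using congr($h₁ (toOpcycles x.toAdd))
  obtain ⟨γ, hγ⟩ := (QuotientAddGroup.eq_zero_iff _).1 h₄
  exact ⟨γ.toMul, congrArg Multiplicative.ofAdd hγ⟩

end PathConnected

/-! ### Lifting loops along an inductive covering -/

lemma homotopyClass_cast {Z : Type u} [TopologicalSpace Z] {x y x' y' : Z}
    (γ : Path.Homotopic.Quotient x y) (hx : x' = x) (hy : y' = y) :
    homotopyClass (γ.cast hx hy) = homotopyClass γ := by
  subst hx hy
  rw [Path.Homotopic.Quotient.cast_rfl_rfl]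

variable {X Y : Type u} [TopologicalSpace X] [TopologicalSpace Y] {π : C(X, Y)}

/-- A path in `V` that starts at `π x` lifts to a path in `π⁻¹(V)` that starts at `x`; its end is
determined by monodromy. -/
lemma exists_lift_in_preimage (hπ : IsCoveringMap π) {V : Set Y} {x : X} (hx : π x ∈ V) {w : V}
    (b : Path (⟨π x, hx⟩ : V) w) :
    ∃ (x' : X) (hx' : π x' ∈ V) (hw : π x' = w) (b' : Path (⟨x, hx⟩ : π ⁻¹' V) ⟨x', hx'⟩),
      (∀ t, π (b' t) = b t) ∧
      hπ.monodromy (.mk (b.map continuous_subtype_val)) ⟨x, rfl⟩ = ⟨x', hw⟩ := by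
  let f : C(I, Y) := (subsetIncl V).comp (b : C(I, V))
  have hf : f 0 = π x := by simp [f, subsetIncl]
  have h (t : I) : π (hπ.liftPath f x hf t) = b t := congr($(hπ.liftPath_lifts f x hf) t)
  have hV (t : I) : hπ.liftPath f x hf t ∈ π ⁻¹' V := by simp [h]
  refine ⟨hπ.liftPath f x hf 1, hV 1, by simp [h],
    ⟨⟨fun t ↦ ⟨_, hV t⟩, (hπ.liftPath f x hf).continuous.subtype_mk _⟩,
      Subtype.ext (hπ.liftPath_zero f x hf), rfl⟩, h, rfl⟩

lemma _root_.IsCoveringMap.surjective_of_pathConnectedSpace [Nonempty X] [PathConnectedSpace Y]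
    (hπ : IsCoveringMap π) : Function.Surjective π := fun y ↦
  let x := Classical.arbitrary X
  ⟨_, (hπ.monodromy (.mk (PathConnectedSpace.somePath (π x) y)) ⟨x, rfl⟩).2⟩

/-- For an inductive covering, a loop whose homology class comes from a class `a` upstairs is itself
the image of a loop, and that loop can be chosen to have class `a`. -/
lemma exists_map_eq_of_hurewicz_eq (hπ : IsInductiveCovering π) (x : X)
    (γ : FundamentalGroup Y (π x)) (a : H1 X) (h : (hurewicz (π x) γ).toAdd = H1.map π a) :
    ∃ ξ : FundamentalGroup X x, FundamentalGroup.map π x ξ = γ ∧ (hurewicz x ξ).toAdd = a := by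
  have := hπ.pathConnected_source
  have := hπ.pathConnected_target
  obtain ⟨ξ, hξ⟩ := hurewicz_surjective x (.ofAdd a)
  have hker : γ * (FundamentalGroup.map π x ξ)⁻¹ ∈ (hurewicz (π x)).ker := by
    rw [MonoidHom.mem_ker, map_mul, map_inv, mul_inv_eq_one]
    apply Multiplicative.toAdd.injective
    rw [h, hurewicz_map, hξ, toAdd_ofAdd]
  obtain ⟨c, hc, hcγ⟩ := (hπ.bijOn_commutator x).surjOn (ker_hurewicz_le _ hker)
  have hc' : hurewicz x c = 1 := Abelianization.commutator_subset_ker _ hc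
  refine ⟨c * ξ, ?_, ?_⟩
  · rw [map_mul, hcγ, inv_mul_cancel_right]
  · rw [map_mul, hc', one_mul, hξ, toAdd_ofAdd]

variable {V : Set Y}

/-- If `H₁(V)` and `H₁(X)` generate `H₁(Y)`, then `π₁(V)` acts transitively on the fibres over `V`,
so that `π⁻¹(V)` is path-connected. -/
theorem isPathConnected_preimage (hπ : IsInductiveCovering π) (hV : IsPathConnected V)
    (h : (H1.map (subsetIncl V)).range ⊔ (H1.map π).range = ⊤) : IsPathConnected (π ⁻¹' V) := by
  have := hπ.pathConnected_source
  have := hπ.pathConnected_target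
  have : PathConnectedSpace V := isPathConnected_iff_pathConnectedSpace.1 hV
  have cov := hπ.isCoveringMap
  obtain ⟨y, hy⟩ := hV.nonempty
  obtain ⟨x, rfl⟩ := cov.surjective_of_pathConnectedSpace y
  -- Points of one fibre are joined inside `π⁻¹(V)`: lifts of paths in `V` then reduce the general
  -- case to this one.
  have fibre (x' : X) (hx' : π x' = π x) : JoinedIn (π ⁻¹' V) x x' := by
    let α : Path.Homotopic.Quotient x x' := .mk (PathConnectedSpace.somePath x x')
    let γ : FundamentalGroup Y (π x) := FundamentalGroup.fromPath ((α.map π).cast rfl hx'.symm)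
    obtain ⟨_, ⟨v, rfl⟩, _, ⟨a, rfl⟩, hva⟩ :=
      AddSubgroup.mem_sup.1 (h ▸ AddSubgroup.mem_top (hurewicz (π x) γ).toAdd)
    obtain ⟨β, hβ⟩ := hurewicz_surjective (⟨π x, hy⟩ : V) (.ofAdd v)
    let β' : FundamentalGroup Y (π x) := FundamentalGroup.map (subsetIncl V) ⟨π x, hy⟩ β
    have hβ' : (hurewicz (π x) β').toAdd = H1.map (subsetIncl V) v :=
      (hurewicz_map (subsetIncl V) ⟨π x, hy⟩ β).trans (by rw [hβ, toAdd_ofAdd])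
    obtain ⟨ξ, hξ, -⟩ := exists_map_eq_of_hurewicz_eq hπ x (β'⁻¹ * γ) a (by
      rw [map_mul, map_inv, toAdd_mul, toAdd_inv, hβ', ← hva, neg_add_cancel_left])
    -- The product in the fundamental group is in reverse order of concatenation: the loop that
    -- comes from `X` is run through first, and the one in `V` last.
    have hγ : γ = Path.Homotopic.Quotient.trans (FundamentalGroup.map π x ξ).toPath β'.toPath := by
      change γ = β' * FundamentalGroup.map π x ξ
      rw [hξ, mul_inv_cancel_left]
    have m₁ : cov.monodromy γ.toPath ⟨x, rfl⟩ = ⟨x', hx'⟩ :=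
      cov.monodromy_eq_of_map_eq α (by simp [γ]; rfl)
    have m₂ : cov.monodromy (FundamentalGroup.map π x ξ).toPath ⟨x, rfl⟩ = ⟨x, rfl⟩ :=
      cov.monodromy_map ξ.toPath
    have m₃ : cov.monodromy β'.toPath ⟨x, rfl⟩ = ⟨x', hx'⟩ := by
      rw [← m₁, hγ, FundamentalGroup.toPath, FundamentalGroup.toArrow, cov.monodromy_trans_apply]
      exact congrArg _ m₂.symm
    obtain ⟨b, rfl⟩ := Path.Homotopic.Quotient.mk_surjective β
    obtain ⟨x'', hx'', hb, b', hb', m₄⟩ := exists_lift_in_preimage cov hy b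
    obtain rfl : x' = x'' := congrArg Subtype.val (m₃.symm.trans m₄)
    exact ⟨b'.map continuous_subtype_val, fun t ↦ (b' t).2⟩
  refine ⟨x, hy, fun {u} hu ↦ ?_⟩
  obtain ⟨x', hx', hb, b, -⟩ := exists_lift_in_preimage cov hu
    (PathConnectedSpace.somePath (⟨π u, hu⟩ : V) ⟨π x, hy⟩)
  exact (fibre x' hb).trans (JoinedIn.symm ⟨b.map continuous_subtype_val, fun t ↦ (b t).2⟩)

/-- A loop in `Y` lifts to a path between two points of a fibre. Closing it up inside a
path-connected `π⁻¹(V)` changes its class by a class coming from `V`. -/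
theorem range_sup_range_eq_top (hπ : IsInductiveCovering π)
    (hU : IsPathConnected (π ⁻¹' V)) :
    (H1.map (subsetIncl V)).range ⊔ (H1.map π).range = ⊤ := by
  have := hπ.pathConnected_target
  have : PathConnectedSpace (π ⁻¹' V) := isPathConnected_iff_pathConnectedSpace.1 hU
  have cov := hπ.isCoveringMap
  obtain ⟨x, hx⟩ := hU.nonempty
  refine eq_top_iff.2 fun c _ ↦ ?_
  obtain ⟨γ, hγ⟩ := hurewicz_surjective (π x) (.ofAdd c)
  let x' := cov.monodromy γ.toPath ⟨x, rfl⟩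
  have hx'x : π x' = π x := x'.2
  have hx'V : π x' ∈ V := hx'x.symm ▸ (show π x ∈ V from hx)
  let Γ : Path.Homotopic.Quotient x x' := cov.liftPathQuotient γ.toPath ⟨x, rfl⟩
  have hΓ : Γ.map π = γ.toPath.cast rfl hx'x := cov.map_liftPathQuotient γ.toPath ⟨x, rfl⟩
  let b : Path (⟨x, hx⟩ : π ⁻¹' V) ⟨x', hx'V⟩ := PathConnectedSpace.somePath _ _
  let β : Path (⟨π x, hx⟩ : V) ⟨π x, hx⟩ :=
    { toFun t := ⟨π (b t), (b t).2⟩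
      continuous_toFun := by fun_prop
      source' := by simp
      target' := Subtype.ext (by simpa using hx'x) }
  let ξ : Path.Homotopic.Quotient x x := Γ.trans (.symm (.mk (b.map continuous_subtype_val)))
  have hξ : FundamentalGroup.map π x ξ =
      (Γ.map π).trans (.symm (.mk ((b.map continuous_subtype_val).map π.continuous))) :=
    (FundamentalGroupoid.map π).map_comp (X := ⟨x⟩) (Y := ⟨x'⟩) (Z := ⟨x⟩) Γ _
  -- `β` and the image of `b` are the same map to `Y`, so their contributions cancel.
  have key : c = H1.map (subsetIncl V) (hurewicz (⟨π x, hx⟩ : V) (.mk β)).toAdd +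
      H1.map π (hurewicz x ξ).toAdd := by
    rw [← hurewicz_map, ← hurewicz_map, hξ]
    apply toOpcycles_injective
    rw [map_add, toOpcycles_hurewicz, toOpcycles_hurewicz, ← toAdd_ofAdd c, ← hγ,
      toOpcycles_hurewicz]
    change _ = _ + homotopyClass (Path.Homotopic.Quotient.trans _ _)
    rw [homotopyClass_trans, hΓ, homotopyClass_symm, homotopyClass_cast]
    have : homotopyClass (FundamentalGroup.map (subsetIncl V) ⟨π x, hx⟩ (.mk β)).toPath =
      homotopyClass (.mk ((b.map continuous_subtype_val).map π.continuous)) := rfl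
    rw [this]
    abel
  rw [key]
  exact AddSubgroup.add_mem_sup ⟨_, rfl⟩ ⟨_, rfl⟩

/-- Representing the `V`-part of `π_* c` by a loop that lifts to `π⁻¹(V)` exhibits `c`, up to an
element of `L`, as a class coming from `π⁻¹(V)`. -/
theorem range_preimage_sup_eq_top (hπ : IsInductiveCovering π) (hV : IsPathConnected V)
    (L : AddSubgroup (H1 X)) (h : (H1.map (subsetIncl V)).range ⊔ L.map (H1.map π) = ⊤) :
    (H1.map (subsetIncl (π ⁻¹' V))).range ⊔ L = ⊤ := by
  have := hπ.pathConnected_source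
  have := hπ.pathConnected_target
  have : PathConnectedSpace V := isPathConnected_iff_pathConnectedSpace.1 hV
  have cov := hπ.isCoveringMap
  obtain ⟨y, hy⟩ := hV.nonempty
  obtain ⟨x, rfl⟩ := cov.surjective_of_pathConnectedSpace y
  refine eq_top_iff.2 fun c _ ↦ ?_
  obtain ⟨_, ⟨v, rfl⟩, _, ⟨l, hl, rfl⟩, hvl⟩ :=
    AddSubgroup.mem_sup.1 (h ▸ AddSubgroup.mem_top (H1.map π c))
  obtain ⟨β, hβ⟩ := hurewicz_surjective (⟨π x, hy⟩ : V) (.ofAdd v)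
  let β' : FundamentalGroup Y (π x) := FundamentalGroup.map (subsetIncl V) ⟨π x, hy⟩ β
  have hβ' : (hurewicz (π x) β').toAdd = H1.map (subsetIncl V) v :=
    (hurewicz_map (subsetIncl V) ⟨π x, hy⟩ β).trans (by rw [hβ, toAdd_ofAdd])
  obtain ⟨ξ, hξ, hξc⟩ := exists_map_eq_of_hurewicz_eq hπ x β' (c - l) (by
    rw [hβ', map_sub, ← hvl]; exact (add_sub_cancel_right _ _).symm)
  have m₃ : cov.monodromy β'.toPath ⟨x, rfl⟩ = ⟨x, rfl⟩ := by
    rw [← hξ]; exact cov.monodromy_map ξ.toPath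
  obtain ⟨b, rfl⟩ := Path.Homotopic.Quotient.mk_surjective β
  obtain ⟨x', hx', hb, b', hb', m₄⟩ := exists_lift_in_preimage cov hy b
  obtain rfl : x = x' := congrArg Subtype.val (m₃.symm.trans m₄)
  -- A covering is injective on homotopy classes of paths, so `ξ` is the class of the lift `b'`.
  have hξb : ξ = FundamentalGroup.map (subsetIncl (π ⁻¹' V)) ⟨x, hy⟩ (.mk b') := by
    refine cov.injective_path_homotopic_map x x (Eq.trans hξ ?_)
    refine congrArg Path.Homotopic.Quotient.mk (?_ : b.map continuous_subtype_val =
      (b'.map continuous_subtype_val).map π.continuous)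
    ext t
    exact (hb' t).symm
  rw [← sub_add_cancel c l, ← hξc, hξb]
  exact AddSubgroup.add_mem_sup ⟨_, (hurewicz_map (subsetIncl (π ⁻¹' V)) ⟨x, hy⟩ _).symm⟩ hl

end

end SingularH1

theorem mainTheorem3 {X Y : Type u} [TopologicalSpace X] [TopologicalSpace Y]
    (π : C(X, Y)) (hπ : IsStronglyInductiveCovering π) (hfin : ∀ y : Y, (π ⁻¹' {y}).Finite) :
    (∀ V : Set Y, IsPathConnected V →
      (IsPathConnected (π ⁻¹' V) ↔
        (H1.map (subsetIncl V)).range ⊔ (H1.map π).range = ⊤)) ∧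
    (∀ (V : Set Y) (L : AddSubgroup (H1 X)),
      IsInductivelyConnected (L.map (H1.map π)) V →
        IsInductivelyConnected L (π ⁻¹' V)) := by
  have hπ := hπ.toIsInductiveCovering
  refine ⟨fun V hV ↦ ⟨SingularH1.range_sup_range_eq_top hπ,
    SingularH1.isPathConnected_preimage hπ hV⟩, fun V L ⟨hV, h⟩ ↦
    ⟨SingularH1.isPathConnected_preimage hπ hV ?_,
      SingularH1.range_preimage_sup_eq_top hπ hV L h⟩⟩
  refine eq_top_iff.2 (h ▸ sup_le_sup_left ?_ _)
  exact (AddSubgroup.map_mono le_top).trans (AddMonoidHom.range_eq_map _).ge
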